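/- Let $\mathfrak A$ be a $C^*$-algebra, let $H$ be a Hilbert $\mathfrak A$-module, and let $\mathcal L(H)$ be the $C^*$-algebra of adjointable operators on $H$. For $T\in\mathcal L(H)$ put $|T|=(T^*T)^{1/2}$, and write $\mathcal R(T)$ for the range of $T$. For $T,U\in\mathcal L(H)$ we say that $T=U|T|$ is the polar decomposition of $T$ if $U$ is a partial isometry (that is, $U^*U$ is a projection), $T=U|T|$, and $U^*U$ is the projection of $H$ onto $\overline{\mathcal R(T^*)}$. (For a given $T$ such a $U$ need not exist.) Theorem. Let $T,A,S\in\mathcal L(H)$ have the polar decompositions $T=U_T|T|$, $A=U_A|A|$ and $S=U_S|S|$, and suppose that $|T|A=A|T|$. Put $$X=TAS,\qquad Y=|T|\cdot A\cdot|S^*|,\qquad W=U_T^*U_TU_AU_SU_S^*.$$ Then the following five statements are equivalent: (i) $X=U_TU_AU_S|X|$ is the polar decomposition of $X$; (ii) $Y=W|Y|$ is the polar decomposition of $Y$; (iii) $X=U_TU_AU_S|X|$; (iv) $Y=W|Y|$; (v) $|T|\cdot|A|\cdot|S^*|$ is a positive element of $\mathcal L(H)$. -/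

import Mathlib

open scoped InnerProductSpace

namespace HilbertCStarModule

section Operators

variable (𝔄 H : Type*) [NonUnitalCStarAlgebra 𝔄] [PartialOrder 𝔄] [StarOrderedRing 𝔄]
  [NormedAddCommGroup H] [NormedSpace ℂ H] [SMul 𝔄 H] [CStarModule 𝔄 H]

/-- `T' : H → H` is an adjoint of `T` for the `𝔄`-valued inner product of `H`. -/
def IsAdjointOf (T T' : H → H) : Prop :=
  ∀ x y : H, ⟪T x, y⟫_𝔄 = ⟪x, T' y⟫_𝔄

/-- `𝓛(H)`: the algebra of adjointable operators, i.e. of the operators `T` on `H` for which there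
is a map `T'` on `H` with `⟪T x, y⟫ = ⟪x, T' y⟫` for all `x`, `y`. It carries the operator norm. -/
def adjointable : Subalgebra ℂ (H →L[ℂ] H) where
  carrier := {T | ∃ T' : H → H, IsAdjointOf 𝔄 H T T'}
  mul_mem' := by
    rintro S T ⟨S', hS⟩ ⟨T', hT⟩
    exact ⟨fun y => T' (S' y), fun x y => (hS (T x) y).trans (hT x (S' y))⟩
  add_mem' := by
    rintro S T ⟨S', hS⟩ ⟨T', hT⟩
    refine ⟨fun y => S' y + T' y, fun x y => ?_⟩
    rw [CStarModule.inner_add_right, ← hS, ← hT, ← CStarModule.inner_add_left]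
    rfl
  algebraMap_mem' := by
    intro c
    refine ⟨fun y => star c • y, fun x y => ?_⟩
    rw [CStarModule.inner_smul_right_complex, ← CStarModule.inner_smul_left_complex]
    rfl

/-- The type `𝓛(H)` of adjointable operators on the Hilbert `𝔄`-module `H`. -/
abbrev AdjointableOp : Type _ := ↥(adjointable 𝔄 H)

end Operators

section CStarStructure

variable {𝔄 H : Type*} [NonUnitalCStarAlgebra 𝔄] [PartialOrder 𝔄] [StarOrderedRing 𝔄]
  [NormedAddCommGroup H] [NormedSpace ℂ H] [SMul 𝔄 H] [CStarModule 𝔄 H]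

set_option linter.unusedSectionVars false in
theorem eq_of_inner_left {x y : H} (h : ∀ z : H, ⟪z, x⟫_𝔄 = ⟪z, y⟫_𝔄) : x = y := by
  have h0 : ⟪x - y, x - y⟫_𝔄 = 0 := by
    rw [CStarModule.inner_sub_right, h, sub_self]
  exact sub_eq_zero.mp (CStarModule.inner_self.mp h0)

set_option linter.unusedSectionVars false in
theorem IsAdjointOf.symm {T T' : H → H} (h : IsAdjointOf 𝔄 H T T') : IsAdjointOf 𝔄 H T' T := by
  intro x y
  rw [← CStarModule.star_inner y (T' x), ← h, CStarModule.star_inner]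

theorem IsAdjointOf.norm_le {T : H →L[ℂ] H} {T' : H → H} (h : IsAdjointOf 𝔄 H T T') (y : H) :
    ‖T' y‖ ≤ ‖T‖ * ‖y‖ := by
  rcases eq_or_lt_of_le (norm_nonneg (T' y)) with h0 | h0
  · rw [← h0]; positivity
  · have h1 : ‖T' y‖ ^ 2 ≤ (‖T‖ * ‖T' y‖) * ‖y‖ := by
      rw [CStarModule.norm_sq_eq 𝔄, ← h]
      exact (CStarModule.norm_inner_le H).trans (by gcongr; exact T.le_opNorm _)
    nlinarith

/-- The adjoint of an adjointable operator, as a bounded linear operator. -/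
noncomputable def adjointCLM (T : AdjointableOp 𝔄 H) : H →L[ℂ] H :=
  LinearMap.mkContinuous
    { toFun := Classical.choose T.2
      map_add' := fun x y => eq_of_inner_left (𝔄 := 𝔄) fun z => by
        have h := Classical.choose_spec T.2
        rw [CStarModule.inner_add_right, ← h, ← h, ← h, CStarModule.inner_add_right]
      map_smul' := fun c x => eq_of_inner_left (𝔄 := 𝔄) fun z => by
        have h := Classical.choose_spec T.2
        rw [RingHom.id_apply, CStarModule.inner_smul_right_complex, ← h, ← h,
          CStarModule.inner_smul_right_complex] }
    ‖(T : H →L[ℂ] H)‖ (fun y => (Classical.choose_spec T.2).norm_le y)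

theorem isAdjointOf_adjointCLM (T : AdjointableOp 𝔄 H) :
    IsAdjointOf 𝔄 H (T : H →L[ℂ] H) (adjointCLM T) :=
  Classical.choose_spec T.2

/-- The involution `T ↦ T*` of `𝓛(H)`. -/
noncomputable instance : Star (AdjointableOp 𝔄 H) where
  star T := ⟨adjointCLM T, _, (isAdjointOf_adjointCLM T).symm⟩

/-- The defining property of the adjoint. -/
theorem inner_apply_left (T : AdjointableOp 𝔄 H) (x y : H) :
    ⟪(T : H →L[ℂ] H) x, y⟫_𝔄 = ⟪x, (star T : AdjointableOp 𝔄 H).1 y⟫_𝔄 :=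
  isAdjointOf_adjointCLM T x y

theorem star_eq_of_isAdjointOf {S T : AdjointableOp 𝔄 H}
    (h : IsAdjointOf 𝔄 H (T : H →L[ℂ] H) (S : H →L[ℂ] H)) : star T = S := by
  ext y
  exact eq_of_inner_left (𝔄 := 𝔄) fun z => by rw [← inner_apply_left, h]

noncomputable instance : StarRing (AdjointableOp 𝔄 H) where
  star_involutive T := star_eq_of_isAdjointOf (isAdjointOf_adjointCLM T).symm
  star_mul S T := star_eq_of_isAdjointOf fun x y =>
    (inner_apply_left S (T.1 x) y).trans (inner_apply_left T x _)
  star_add S T := star_eq_of_isAdjointOf fun x y => by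
    change ⟪S.1 x + T.1 x, y⟫_𝔄 = ⟪x, (star S).1 y + (star T).1 y⟫_𝔄
    rw [CStarModule.inner_add_left, CStarModule.inner_add_right, inner_apply_left,
      inner_apply_left]

instance : StarModule ℂ (AdjointableOp 𝔄 H) where
  star_smul c T := star_eq_of_isAdjointOf fun x y => by
    change ⟪c • T.1 x, y⟫_𝔄 = ⟪x, star c • (star T).1 y⟫_𝔄
    rw [CStarModule.inner_smul_left_complex, CStarModule.inner_smul_right_complex,
      inner_apply_left]

instance : CStarRing (AdjointableOp 𝔄 H) where
  norm_mul_self_le T := by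
    have h0 : 0 ≤ ‖star T * T‖ := norm_nonneg (star T * T).1
    have h : ‖T.1‖ ≤ √‖star T * T‖ := by
      refine ContinuousLinearMap.opNorm_le_bound _ (Real.sqrt_nonneg _) fun x => ?_
      refine le_of_sq_le_sq ?_ (by positivity)
      rw [mul_pow, Real.sq_sqrt h0, CStarModule.norm_sq_eq 𝔄, inner_apply_left]
      calc ‖⟪x, (star T * T : AdjointableOp 𝔄 H).1 x⟫_𝔄‖
          ≤ ‖x‖ * ‖(star T * T : AdjointableOp 𝔄 H).1 x‖ := CStarModule.norm_inner_le H
        _ ≤ ‖x‖ * (‖(star T * T : AdjointableOp 𝔄 H).1‖ * ‖x‖) := by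
            gcongr; exact ContinuousLinearMap.le_opNorm _ _
        _ = ‖star T * T‖ * ‖x‖ ^ 2 := by
            change ‖x‖ * (‖star T * T‖ * ‖x‖) = _
            ring
    have h2 : ‖T‖ * ‖T‖ ≤ √‖star T * T‖ * √‖star T * T‖ :=
      mul_le_mul h h (norm_nonneg _) (Real.sqrt_nonneg _)
    rwa [Real.mul_self_sqrt h0] at h2

instance [CompleteSpace H] : CompleteSpace (AdjointableOp 𝔄 H) := by
  refine Metric.complete_of_cauchySeq_tendsto fun u hu => ?_
  have hc : CauchySeq fun n => (u n).1 := hu.map uniformContinuous_subtype_val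
  have hc' : CauchySeq fun n => (star (u n)).1 := by
    have hs : UniformContinuous (star : AdjointableOp 𝔄 H → AdjointableOp 𝔄 H) :=
      (starₗᵢ ℂ (E := AdjointableOp 𝔄 H)).isometry.uniformContinuous
    exact hu.map (uniformContinuous_subtype_val.comp hs)
  obtain ⟨T, hT⟩ := cauchySeq_tendsto_of_complete hc
  obtain ⟨T', hT'⟩ := cauchySeq_tendsto_of_complete hc'
  refine ⟨⟨T, T', fun x y => ?_⟩, tendsto_subtype_rng.mpr hT⟩
  have h1 : Filter.Tendsto (fun n => ⟪(u n).1 x, y⟫_𝔄) Filter.atTop (nhds ⟪T x, y⟫_𝔄) :=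
    ((CStarModule.continuous_inner (A := 𝔄) (E := H)).tendsto (T x, y)).comp
      (((ContinuousLinearMap.apply ℂ H x).continuous.tendsto T |>.comp hT).prodMk_nhds
        tendsto_const_nhds)
  have h2 : Filter.Tendsto (fun n => ⟪x, (star (u n)).1 y⟫_𝔄) Filter.atTop (nhds ⟪x, T' y⟫_𝔄) :=
    ((CStarModule.continuous_inner (A := 𝔄) (E := H)).tendsto (x, T' y)).comp
      (tendsto_const_nhds.prodMk_nhds
        ((ContinuousLinearMap.apply ℂ H y).continuous.tendsto T' |>.comp hT'))
  refine tendsto_nhds_unique h1 (h2.congr fun n => ?_)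
  rw [inner_apply_left]

/-- `𝓛(H)` is a unital C⋆-algebra. -/
noncomputable instance [CompleteSpace H] : CStarAlgebra (AdjointableOp 𝔄 H) where

/-- The order of the C⋆-algebra `𝓛(H)`: `0 ≤ T` means that `T` is a positive element, that is,
self-adjoint with spectrum in `[0, ∞)`. -/
noncomputable instance [CompleteSpace H] : PartialOrder (AdjointableOp 𝔄 H) :=
  CStarAlgebra.spectralOrder _

instance [CompleteSpace H] : StarOrderedRing (AdjointableOp 𝔄 H) :=
  CStarAlgebra.spectralOrderedRing _

/-- `P` is the projection `P_M` of `H` onto `M`: a self-adjoint idempotent of `𝓛(H)` with range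
`M`. It exists exactly when `M` is an orthogonally complemented closed submodule of `H` (then
`x = P x + (x - P x)` is the orthogonal decomposition), and it is unique. -/
def IsProjectionOnto (P : AdjointableOp 𝔄 H) (M : Set H) : Prop :=
  IsStarProjection P ∧ Set.range (P : H →L[ℂ] H) = M

/-- `U` is a partial isometry: `U* U` is a projection. -/
def IsPartialIsometry (U : AdjointableOp 𝔄 H) : Prop :=
  IsStarProjection (star U * U)

/-- `T = U |T|` is the polar decomposition of `T`: `U` is a partial isometry, `T = U |T|`, and
`U* U` is the projection onto the closure of the range of `T*`. Here `|T| = (T* T)^(1/2)` in the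
C⋆-algebra `𝓛(H)`. -/
structure IsPolarDecomposition [CompleteSpace H] (T U : AdjointableOp 𝔄 H) : Prop where
  isPartialIsometry : IsPartialIsometry U
  eq_mul_abs : T = U * CFC.abs T
  isProjectionOnto :
    IsProjectionOnto (star U * U) (closure (Set.range (star T : AdjointableOp 𝔄 H).1))

end CStarStructure

end HilbertCStarModule

namespace HilbertCStarModule

set_option linter.unusedSectionVars false

/-! ### Partial isometries and absolute values in a C⋆-algebra -/

section CStarAlgebraFacts

variable {R : Type*} [CStarAlgebra R]

/-! Write t = |T|, a = |A|, c = |S*|, P = U_T*U_T, Q = U_S U_S*, Z = tac. As t is self-adjoint and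
commutes with A, it commutes with U_A (`commute_of_commute`), and so does P. Hence Y = U_A Z, Z =
U_A*Y and |Y| = |Z|. Also X = U_T Y U_S and |X| = U_S*|Y|U_S, and both relations can be inverted, so
(iii) ⇔ (iv). Statement (iv) reads Y = P U_A|Z|. It gives Z = E|Z| for the projection E = U_A*U_A P,
which forces Z = |Z| (`eq_abs_of_eq_mul_abs`). Conversely Z = |Z| gives (iv) back. For the range
conditions in (i) and (ii): if Z ≥ 0 then ta and c commute, so EQ is the projection onto the closed
range of Z (`IsRangeProjection.mul`), which is that of Y*. It equals W*W, and conjugation by U_S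
carries it to X*. -/

/-- With p = u*u, the square (up - u)*(up - u) is p³ - 2p² + p = 0. -/
theorem mul_star_mul_self_of_isStarProjection {u : R} (hu : IsStarProjection (star u * u)) :
    u * (star u * u) = u := by
  have hp : star u * u * (star u * u) = star u * u := hu.isIdempotentElem
  have h : star (u * (star u * u) - u) * (u * (star u * u) - u) = 0 := by
    have e : star (u * (star u * u) - u) * (u * (star u * u) - u) =
        star u * u * (star u * u) * (star u * u) - star u * u * (star u * u)
          - star u * u * (star u * u) + star u * u := by
      simp only [star_sub, star_mul, star_star]
      noncomm_ring
    rw [e, hp, hp]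
    simp
  exact sub_eq_zero.mp ((CStarRing.star_mul_self_eq_zero_iff _).mp h)

theorem isStarProjection_mul_star {u : R} (hu : IsStarProjection (star u * u)) :
    IsStarProjection (u * star u) where
  isIdempotentElem := by
    change u * star u * (u * star u) = u * star u
    rw [← mul_assoc, mul_assoc u, mul_star_mul_self_of_isStarProjection hu]
  isSelfAdjoint := .mul_star_self u

variable [PartialOrder R] [StarOrderedRing R]

/-- The square (xp - x)*(xp - x) depends on x only through x*x, which x and |x| share. -/
theorem abs_mul_of_mul_eq {x p : R} (h : x * p = x) : CFC.abs x * p = CFC.abs x := by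
  have e : star (CFC.abs x * p - CFC.abs x) * (CFC.abs x * p - CFC.abs x) =
      star (x * p - x) * (x * p - x) := by
    have hs := (CFC.abs_nonneg x).star_eq
    have h2 := CFC.abs_mul_abs x
    have e (y : R) : star (y * p - y) * (y * p - y) =
        star p * (star y * y) * p - star p * (star y * y) - star y * y * p + star y * y := by
      simp only [star_sub, star_mul]
      noncomm_ring
    rw [e, e, hs, h2]
  rw [h, sub_self, mul_zero, CStarRing.star_mul_self_eq_zero_iff] at e
  exact sub_eq_zero.mp e

theorem mul_abs_of_mul_eq {x p : R} (hp : IsSelfAdjoint p) (h : x * p = x) :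
    p * CFC.abs x = CFC.abs x := by
  have := congrArg star (abs_mul_of_mul_eq h)
  rwa [star_mul, (CFC.abs_nonneg x).star_eq, hp.star_eq] at this

/-- An element that agrees with a compression of its absolute value is positive. -/
theorem eq_abs_of_eq_mul_abs {x e : R} (he : IsStarProjection e) (h : x = e * CFC.abs x) :
    x = CFC.abs x := by
  have hx : star x * x = CFC.abs x * e * CFC.abs x := by
    conv_lhs => rw [h]
    rw [star_mul, (CFC.abs_nonneg x).star_eq, he.isSelfAdjoint.star_eq, mul_assoc,
      ← mul_assoc e, he.isIdempotentElem.eq, mul_assoc]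
  -- The hypothesis gives |x|² = |x|e|x|, that is, |x|(1 - e)|x| = 0.
  have h0 : star (e * CFC.abs x - CFC.abs x) * (e * CFC.abs x - CFC.abs x) = 0 := by
    have : star (e * CFC.abs x - CFC.abs x) * (e * CFC.abs x - CFC.abs x) =
        CFC.abs x * (e * e) * CFC.abs x - CFC.abs x * e * CFC.abs x
          - CFC.abs x * e * CFC.abs x + CFC.abs x * CFC.abs x := by
      simp only [star_sub, star_mul, (CFC.abs_nonneg x).star_eq, he.isSelfAdjoint.star_eq]
      noncomm_ring
    rw [this, he.isIdempotentElem.eq, CFC.abs_mul_abs, hx]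
    simp
  exact h.trans (sub_eq_zero.mp ((CStarRing.star_mul_self_eq_zero_iff _).mp h0))

/-- Uniqueness of the positive square root: |y| absorbs vv*, so v*|y|v squares to x*x. -/
theorem abs_eq_conj {x y v : R} (hy : CFC.abs y * (v * star v) = CFC.abs y)
    (hx : star x * x = star v * (star y * y) * v) : CFC.abs x = star v * CFC.abs y * v := by
  refine CFC.sqrt_unique ?_ (star_left_conjugate_nonneg (CFC.abs_nonneg y) v)
  rw [hx, ← CFC.abs_mul_abs y]
  calc star v * CFC.abs y * v * (star v * CFC.abs y * v)
      = star v * (CFC.abs y * (v * star v) * CFC.abs y) * v := by simp only [mul_assoc]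
    _ = _ := by rw [hy]

end CStarAlgebraFacts

/-! ### Projections onto closures of ranges -/

section Projections

variable {𝔄 H : Type*} [NonUnitalCStarAlgebra 𝔄] [PartialOrder 𝔄] [StarOrderedRing 𝔄]
  [NormedAddCommGroup H] [NormedSpace ℂ H] [SMul 𝔄 H] [CStarModule 𝔄 H]

theorem mul_apply (B C : AdjointableOp 𝔄 H) (x : H) : (B * C).1 x = B.1 (C.1 x) := rfl

theorem ext_apply {B C : AdjointableOp 𝔄 H} (h : ∀ x, B.1 x = C.1 x) : B = C :=
  Subtype.ext (ContinuousLinearMap.ext h)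

/-- `P` is the projection onto the closure of the range of `B`. -/
abbrev IsRangeProjection (P B : AdjointableOp 𝔄 H) : Prop :=
  IsProjectionOnto P (closure (Set.range B.1))

theorem range_mul_subset (B C : AdjointableOp 𝔄 H) : Set.range (B * C).1 ⊆ Set.range B.1 := by
  rintro _ ⟨x, rfl⟩
  exact ⟨C.1 x, rfl⟩

theorem apply_mem_closure_range_mul (C : AdjointableOp 𝔄 H) {B : AdjointableOp 𝔄 H} {x : H}
    (hx : x ∈ closure (Set.range B.1)) : C.1 x ∈ closure (Set.range (C * B).1) := by
  refine map_mem_closure C.1.continuous hx ?_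
  rintro _ ⟨y, rfl⟩
  exact ⟨y, rfl⟩

theorem eq_on_closure_range {B C D : AdjointableOp 𝔄 H} (h : C * B = D * B) {x : H}
    (hx : x ∈ closure (Set.range B.1)) : C.1 x = D.1 x := by
  refine closure_minimal ?_ (isClosed_eq C.1.continuous D.1.continuous) hx
  rintro _ ⟨y, rfl⟩
  exact congrArg (fun F : AdjointableOp 𝔄 H => F.1 y) h

theorem isRangeProjection_iff {P B : AdjointableOp 𝔄 H} :
    IsRangeProjection P B ↔
      IsStarProjection P ∧ P * B = B ∧ ∀ x, P.1 x ∈ closure (Set.range B.1) := by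
  constructor
  · rintro ⟨hP, hr⟩
    refine ⟨hP, ext_apply fun x => ?_, fun x => hr ▸ ⟨x, rfl⟩⟩
    obtain ⟨y, hy⟩ : B.1 x ∈ Set.range P.1 := hr ▸ subset_closure ⟨x, rfl⟩
    rw [mul_apply, ← hy, ← mul_apply, hP.isIdempotentElem.eq]
  · rintro ⟨hP, hB, hr⟩
    refine ⟨hP, Set.Subset.antisymm (Set.range_subset_iff.mpr hr) fun x hx => ⟨x, ?_⟩⟩
    exact eq_on_closure_range (D := 1) (by rw [hB, one_mul]) hx

theorem IsRangeProjection.of_range_eq {P B C : AdjointableOp 𝔄 H} (h : IsRangeProjection P B)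
    {F G : AdjointableOp 𝔄 H} (hC : C = B * F) (hB : B = C * G) : IsRangeProjection P C := by
  have : Set.range C.1 = Set.range B.1 :=
    Set.Subset.antisymm (hC ▸ range_mul_subset B F)
      (by conv_lhs => rw [hB]
          exact range_mul_subset C G)
  exact ⟨h.1, by rw [this]; exact h.2⟩

theorem IsRangeProjection.mul_eq {P B : AdjointableOp 𝔄 H} (h : IsRangeProjection P B) :
    P * B = B := (isRangeProjection_iff.mp h).2.1

theorem IsRangeProjection.apply_mem {P B : AdjointableOp 𝔄 H} (h : IsRangeProjection P B) (x : H) :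
    P.1 x ∈ closure (Set.range B.1) := (isRangeProjection_iff.mp h).2.2 x

theorem IsRangeProjection.eq_mul {P B : AdjointableOp 𝔄 H} (h : IsRangeProjection P B)
    (hB : IsSelfAdjoint B) : B * P = B := by
  have := congrArg star h.mul_eq
  rwa [star_mul, hB.star_eq, h.1.isSelfAdjoint.star_eq] at this

theorem IsRangeProjection.mul_right_cancel {P B C D : AdjointableOp 𝔄 H}
    (h : IsRangeProjection P B) (hCD : C * B = D * B) : C * P = D * P :=
  ext_apply fun x => eq_on_closure_range hCD (h.apply_mem x)

/-- P need not lie in the C⋆-algebra generated by B, so functional calculus does not apply. Instead,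
any D commuting with B preserves the closed range, so PDP = DP; use this for C and C* and take
adjoints. -/
theorem IsRangeProjection.commute {P B C : AdjointableOp 𝔄 H} (h : IsRangeProjection P B)
    (h₁ : Commute C B) (h₂ : Commute (star C) B) : Commute C P := by
  have key {D : AdjointableOp 𝔄 H} (hD : Commute D B) : P * (D * P) = D * P := by
    have : P * D * B = D * B := by rw [mul_assoc, hD.eq, ← mul_assoc, h.mul_eq]
    rw [← mul_assoc, h.mul_right_cancel this]
  have h3 := congrArg star (key h₂)
  simp only [star_mul, star_star, h.1.isSelfAdjoint.star_eq] at h3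
  change C * P = P * C
  rw [← key h₁, ← h3, mul_assoc]

theorem IsRangeProjection.mul {P Q B C : AdjointableOp 𝔄 H} (hP : IsRangeProjection P B)
    (hQ : IsRangeProjection Q C) (hB : IsSelfAdjoint B) (hC : IsSelfAdjoint C)
    (h : Commute B C) : IsRangeProjection (P * Q) (B * C) := by
  have hBQ : Commute B Q := hQ.commute h (by rwa [hB.star_eq])
  have hCP : Commute C P := hP.commute h.symm (by rw [hC.star_eq]; exact h.symm)
  have hPQ : Commute Q P :=
    hP.commute hBQ.symm (by rw [hQ.1.isSelfAdjoint.star_eq]; exact hBQ.symm)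
  refine isRangeProjection_iff.mpr ⟨hP.1.mul hQ.1 hPQ.symm, ?_, fun x => ?_⟩
  · rw [mul_assoc, ← mul_assoc Q, ← hBQ.eq, mul_assoc B, hQ.mul_eq, ← mul_assoc, hP.mul_eq]
  · have h1 := apply_mem_closure_range_mul P (hQ.apply_mem x)
    refine closure_minimal ?_ isClosed_closure h1
    rintro _ ⟨y, rfl⟩
    rw [← hCP.eq, h.eq]
    exact apply_mem_closure_range_mul C (hP.apply_mem y)

/-- Transport of a range projection `E` for `B` along a partial isometry `V` whose final
projection commutes with `E`. -/
theorem IsRangeProjection.conj {E B V : AdjointableOp 𝔄 H} (hE : IsRangeProjection E B)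
    (hV : V * star V * V = V) (hc : Commute E (V * star V)) :
    IsRangeProjection (star V * E * V) (star V * B) := by
  refine isRangeProjection_iff.mpr ⟨⟨?_, ?_⟩, ?_, fun x => ?_⟩
  · change star V * E * V * (star V * E * V) = star V * E * V
    calc star V * E * V * (star V * E * V) = star V * (E * (V * star V)) * E * V := by
          simp only [mul_assoc]
      _ = star (V * star V * V) * (E * E) * V := by
          rw [hc.eq]; simp only [star_mul, star_star, mul_assoc]
      _ = star V * E * V := by rw [hV, hE.1.isIdempotentElem.eq]
  · change star (star V * E * V) = star V * E * V
    simp only [star_mul, star_star, hE.1.isSelfAdjoint.star_eq, mul_assoc]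
  · calc star V * E * V * (star V * B) = star V * (E * (V * star V)) * B := by
          simp only [mul_assoc]
      _ = star (V * star V * V) * (E * B) := by
          rw [hc.eq]; simp only [star_mul, star_star, mul_assoc]
      _ = star V * B := by rw [hV, hE.mul_eq]
  · rw [mul_assoc]
    exact apply_mem_closure_range_mul (star V) (hE.apply_mem (V.1 x))

end Projections

/-! ### Polar decompositions -/

section Polar

variable {𝔄 H : Type*} [NonUnitalCStarAlgebra 𝔄] [PartialOrder 𝔄] [StarOrderedRing 𝔄]
  [NormedAddCommGroup H] [NormedSpace ℂ H] [SMul 𝔄 H] [CStarModule 𝔄 H] [CompleteSpace H]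

namespace IsPolarDecomposition

set_option linter.unusedSectionVars false

variable {T U : AdjointableOp 𝔄 H}

theorem mul_initial (h : IsPolarDecomposition T U) : T * (star U * U) = T := by
  have := congrArg star (IsRangeProjection.mul_eq h.isProjectionOnto)
  rwa [star_mul, star_star, h.isPartialIsometry.isSelfAdjoint.star_eq] at this

theorem star_mul_eq_abs (h : IsPolarDecomposition T U) : star U * T = CFC.abs T := by
  conv_lhs => rw [h.eq_mul_abs]
  rw [← mul_assoc,
    mul_abs_of_mul_eq h.isPartialIsometry.isSelfAdjoint h.mul_initial]

theorem isRangeProjection_abs (h : IsPolarDecomposition T U) :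
    IsRangeProjection (star U * U) (CFC.abs T) := by
  refine IsRangeProjection.of_range_eq h.isProjectionOnto (F := U) (G := star U) ?_ ?_
  · rw [← (CFC.abs_nonneg T).star_eq, ← h.star_mul_eq_abs, star_mul, star_star]
  · conv_lhs => rw [h.eq_mul_abs]
    rw [star_mul, (CFC.abs_nonneg T).star_eq]

theorem mul_star_mul_self (h : IsPolarDecomposition T U) : U * star U * U = U := by
  rw [mul_assoc]
  exact mul_star_mul_self_of_isStarProjection h.isPartialIsometry

theorem abs_star_eq (h : IsPolarDecomposition T U) :
    CFC.abs (star T) = U * CFC.abs T * star U := by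
  have := abs_eq_conj (x := star T) (y := T) (v := star U) ?_ ?_
  · rwa [star_star] at this
  · rw [star_star]
    exact abs_mul_of_mul_eq h.mul_initial
  · rw [star_star, star_star, ← CFC.abs_mul_abs T]
    conv_lhs => rw [h.eq_mul_abs]
    rw [star_mul, (CFC.abs_nonneg T).star_eq]
    simp only [mul_assoc]

theorem abs_star_mul (h : IsPolarDecomposition T U) : CFC.abs (star T) * U = T := by
  rw [h.abs_star_eq, mul_assoc, mul_assoc, abs_mul_of_mul_eq h.mul_initial, ← h.eq_mul_abs]

theorem final_mul (h : IsPolarDecomposition T U) : U * star U * T = T := by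
  rw [mul_assoc, h.star_mul_eq_abs, ← h.eq_mul_abs]

theorem star (h : IsPolarDecomposition T U) : IsPolarDecomposition (star T) (star U) := by
  have hp := isStarProjection_mul_star h.isPartialIsometry
  refine ⟨by rwa [IsPartialIsometry, star_star], ?_, ?_⟩
  · rw [h.abs_star_eq, ← mul_assoc, ← mul_assoc,
      (isRangeProjection_abs h).mul_eq, ← (CFC.abs_nonneg T).star_eq, ← star_mul, ← h.eq_mul_abs]
  · rw [star_star, star_star]
    refine isRangeProjection_iff.mpr ⟨hp, h.final_mul, fun x => ?_⟩
    have h1 := apply_mem_closure_range_mul U (h.isRangeProjection_abs.apply_mem ((Star.star U).1 x))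
    rw [← h.eq_mul_abs, ← mul_apply, ← mul_apply, ← mul_assoc, h.mul_star_mul_self] at h1
    exact h1

/-- Whatever commutes with `T` and `T*` commutes with the polar part of `T`. -/
theorem commute_of_commute (h : IsPolarDecomposition T U) {B : AdjointableOp 𝔄 H}
    (hB : IsSelfAdjoint B) (hBT : Commute B T) : Commute B U := by
  have hBT' : Commute B (Star.star T) := by
    have := hBT.star_star
    rwa [hB.star_eq] at this
  have hBabs : Commute B (CFC.abs T) :=
    Commute.cfcAbs_right hBT.symm (by rw [hB.star_eq]; exact hBT.symm)
  have hP : Commute B (Star.star U * U) :=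
    h.isRangeProjection_abs.commute hBabs (by rwa [hB.star_eq])
  -- BU and UB agree on the range of |T|, hence after right multiplication by U*U. Since B commutes
  -- with U*U, that factor is absorbed into U.
  have h1 : B * U * CFC.abs T = U * B * CFC.abs T := by
    rw [mul_assoc, ← h.eq_mul_abs, mul_assoc, hBabs.eq, ← mul_assoc, ← h.eq_mul_abs, hBT.eq]
  have h2 := h.isRangeProjection_abs.mul_right_cancel h1
  have hU := mul_star_mul_self_of_isStarProjection h.isPartialIsometry
  rwa [mul_assoc, hU, mul_assoc, hP.eq, ← mul_assoc, hU] at h2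

end IsPolarDecomposition

end Polar

end HilbertCStarModule

/-! ### The equivalence of the five statements -/

set_option maxHeartbeats 1600000 in
open HilbertCStarModule in
theorem theorem4p8 {𝔄 H : Type*}
    [NonUnitalCStarAlgebra 𝔄] [PartialOrder 𝔄] [StarOrderedRing 𝔄]
    [NormedAddCommGroup H] [NormedSpace ℂ H] [SMul 𝔄 H] [CStarModule 𝔄 H] [CompleteSpace H]
    (T A S U_T U_A U_S : AdjointableOp 𝔄 H)
    (hT : IsPolarDecomposition T U_T)
    (hA : IsPolarDecomposition A U_A)
    (hS : IsPolarDecomposition S U_S)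
    (hTA : ⁅CFC.abs T, A⁆ = 0)
    (X Y W : AdjointableOp 𝔄 H)
    (hX : X = T * A * S)
    (hY : Y = CFC.abs T * A * CFC.abs (star S))
    (hW : W = star U_T * U_T * U_A * U_S * star U_S) :
    List.TFAE
      [IsPolarDecomposition X (U_T * U_A * U_S),
       IsPolarDecomposition Y W,
       X = U_T * U_A * U_S * CFC.abs X,
       Y = W * CFC.abs Y,
       0 ≤ CFC.abs T * CFC.abs A * CFC.abs (star S)] := by
  have ht : IsSelfAdjoint (CFC.abs T) := (CFC.abs_nonneg T).isSelfAdjoint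
  have ha : IsSelfAdjoint (CFC.abs A) := (CFC.abs_nonneg A).isSelfAdjoint
  have hc : IsSelfAdjoint (CFC.abs (star S)) := (CFC.abs_nonneg _).isSelfAdjoint
  have hP := hT.isRangeProjection_abs
  have hPA := hA.isRangeProjection_abs
  have hQ := hS.star.isRangeProjection_abs
  rw [star_star] at hQ
  have hSabs := hS.abs_star_mul
  have hSU : S * star U_S = CFC.abs (star S) := by
    have := congrArg star hS.star.star_mul_eq_abs
    rwa [star_mul, star_star, star_star, hc.star_eq] at this
  have hTabs := hT.eq_mul_abs
  have hUT := hT.star_mul_eq_abs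
  have hAabs := hA.eq_mul_abs
  have hUA := hA.star_mul_eq_abs
  have hUS := hS.mul_star_mul_self
  have htA : Commute (CFC.abs T) A := commute_iff_lie_eq.mpr hTA
  have hta : Commute (CFC.abs T) (CFC.abs A) :=
    Commute.cfcAbs_right htA.symm (by rw [ht.star_eq]; exact htA.symm)
  have htU : Commute (CFC.abs T) U_A := hA.commute_of_commute ht htA
  have htU' : Commute (CFC.abs T) (star U_A) := by
    have := htU.star_star
    rwa [ht.star_eq] at this
  have hPU : Commute (star U_T * U_T) U_A := (hP.commute htU.symm htU'.symm).symm
  have hPU' : Commute (star U_T * U_T) (star U_A) := by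
    have := hPU.star_star
    rwa [hP.1.isSelfAdjoint.star_eq] at this
  have hE : IsRangeProjection (star U_A * U_A * (star U_T * U_T)) (CFC.abs T * CFC.abs A) := by
    rw [hta.eq]
    exact hPA.mul hP ha ht hta.symm
  have habs : IsSelfAdjoint (CFC.abs T * CFC.abs A) := by
    change star _ = _
    rw [star_mul, ht.star_eq, ha.star_eq, hta.eq]
  generalize CFC.abs T = t at *
  generalize CFC.abs A = a at *
  generalize CFC.abs (star S) = c at *
  generalize hPd : star U_T * U_T = P at *
  generalize hEd : star U_A * U_A * P = E at *
  generalize hQd : U_S * star U_S = Q at *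
  generalize hZ : t * a * c = Z
  have hYZ : Y = U_A * Z := by
    rw [hY, ← hZ, hAabs]
    simp only [← mul_assoc]
    rw [htU.eq]
  have hZY : Z = star U_A * Y := by
    rw [hY, ← hZ, ← hUA]
    simp only [← mul_assoc]
    rw [htU'.eq]
  have hPY : P * Y = Y := by rw [hY, mul_assoc, ← mul_assoc P, hP.mul_eq]
  have hPZ : P * Z = Z := by rw [hZY, ← mul_assoc, hPU'.eq, mul_assoc, hPY]
  have hcQ : c * Q = c := hQ.eq_mul hc
  have hYQ : Y * Q = Y := by rw [hY, mul_assoc, hcQ]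
  have hYabs : CFC.abs Y = CFC.abs Z := by
    have : star Y * Y = star Z * Z := by
      conv_lhs => rw [hYZ, star_mul, mul_assoc, ← hYZ, ← hZY]
    rw [CFC.abs, CFC.abs, this]
  have hXY : X = U_T * Y * U_S := by
    rw [hX, hY, hTabs, ← hSabs]
    simp only [mul_assoc]
  have hYX : Y = star U_T * X * star U_S := by
    rw [hX, hY, ← hUT, ← hSU]
    simp only [mul_assoc]
  have hYabsQ : CFC.abs Y * Q = CFC.abs Y := abs_mul_of_mul_eq hYQ
  have hQYabs : Q * CFC.abs Y = CFC.abs Y := mul_abs_of_mul_eq hQ.1.isSelfAdjoint hYQ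
  have hXabs : CFC.abs X = star U_S * CFC.abs Y * U_S := by
    refine abs_eq_conj (by rw [hQd, hYabsQ]) ?_
    conv_lhs => rw [hXY]
    calc star (U_T * Y * U_S) * (U_T * Y * U_S)
        = star U_S * (star Y * (star U_T * U_T * Y)) * U_S := by
          simp only [star_mul, mul_assoc]
      _ = _ := by rw [hPd, hPY]
  have hYabsX : CFC.abs Y = U_S * CFC.abs X * star U_S := by
    calc CFC.abs Y = Q * (CFC.abs Y * Q) := by rw [hYabsQ, hQYabs]
      _ = _ := by rw [hXabs, ← hQd]; simp only [mul_assoc]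
  have hWY : W * CFC.abs Y = P * U_A * CFC.abs Y := by
    rw [hW, mul_assoc _ U_S, hQd, mul_assoc, hQYabs]
  have hXiff : X = U_T * U_A * U_S * CFC.abs X ↔ Y = W * CFC.abs Y := by
    rw [hWY]
    constructor
    · intro h
      conv_lhs => rw [hYX, h]
      rw [hYabsX, ← hPd]
      simp only [mul_assoc]
    · intro h
      have hUP : U_T * P = U_T := by rw [← hPd, ← mul_assoc, hT.mul_star_mul_self]
      conv_lhs => rw [hXY, h]
      calc U_T * (P * U_A * CFC.abs Y) * U_S
          = U_T * P * U_A * (Q * CFC.abs Y) * U_S := by rw [hQYabs]; simp only [mul_assoc]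
        _ = _ := by rw [hUP, hXabs, ← hQd]; simp only [mul_assoc]
  have hpos : Y = W * CFC.abs Y → 0 ≤ Z := by
    rw [hWY, hYabs]
    intro h
    have : Z = E * CFC.abs Z := by
      conv_lhs => rw [hZY, h]
      rw [← hEd, hPU.eq]
      simp only [mul_assoc]
    rw [eq_abs_of_eq_mul_abs hE.1 this]
    exact CFC.abs_nonneg Z
  have hpos' (h : 0 ≤ Z) : Y = W * CFC.abs Y := by
    rw [hWY, hYabs, CFC.abs_of_nonneg Z h, hPU.eq, mul_assoc, hPZ, ← hYZ]
  -- Both ta and c are self-adjoint, so Z* = Z says exactly that they commute.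
  have hcomm (h : 0 ≤ Z) : Commute (t * a) c := by
    have := h.star_eq
    rwa [← hZ, star_mul, habs.star_eq, hc.star_eq, eq_comm] at this
  have hEQ (h : 0 ≤ Z) : Commute E Q := by
    have h1 : Commute E c :=
      (hE.commute (hcomm h).symm (by rw [hc.star_eq]; exact (hcomm h).symm)).symm
    exact hQ.commute h1 (by rwa [hE.1.isSelfAdjoint.star_eq])
  have hEQY (h : 0 ≤ Z) : IsRangeProjection (E * Q) (star Y) := by
    have h1 := hE.mul hQ habs hc (hcomm h)
    rw [hZ] at h1
    -- Y* = Z U_A* and Z = Y*U_A, so the two ranges coincide.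
    refine h1.of_range_eq (F := star U_A) (G := U_A) ?_ ?_
    · rw [hYZ, star_mul, h.star_eq]
    · conv_lhs => rw [← h.star_eq, hZY, star_mul, star_star]
  have hPPE : star U_A * P * U_A = E := by rw [← hEd, mul_assoc, hPU.eq, ← mul_assoc]
  tfae_have 1 → 3 := fun h => h.eq_mul_abs
  tfae_have 2 → 4 := fun h => h.eq_mul_abs
  tfae_have 3 ↔ 4 := hXiff
  tfae_have 4 → 5 := hpos
  tfae_have 5 → 2 := by
    intro h
    have hWW : star W * W = E * Q := by
      have hWQ : W = P * U_A * Q := by rw [hW, mul_assoc _ U_S, hQd]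
      calc star W * W = Q * (star U_A * (P * P) * U_A) * Q := by
            rw [hWQ]
            simp only [star_mul, hP.1.isSelfAdjoint.star_eq, hQ.1.isSelfAdjoint.star_eq, mul_assoc]
        _ = E * Q := by
            rw [hP.1.isIdempotentElem.eq, hPPE, ← (hEQ h).eq, mul_assoc,
              hQ.1.isIdempotentElem.eq]
    have := hEQY h
    rw [← hWW] at this
    exact ⟨this.1, hpos' h, this⟩
  tfae_have 5 → 1 := by
    intro h
    have hVV : star (U_T * U_A * U_S) * (U_T * U_A * U_S) = star U_S * (E * Q) * U_S := by
      calc star (U_T * U_A * U_S) * (U_T * U_A * U_S)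
          = star U_S * (star U_A * (star U_T * U_T) * U_A) * U_S := by
            simp only [star_mul, mul_assoc]
        _ = star U_S * (E * (U_S * star U_S)) * U_S := by
            rw [hPd, hPPE, hQd, mul_assoc _ (E * Q), mul_assoc E, hUS, mul_assoc]
        _ = _ := by rw [hQd]
    have hcQ : Commute (E * Q) (U_S * star U_S) := by
      rw [hQd]
      exact (hEQ h).mul_left (Commute.refl Q)
    -- This treats U_S*Y*. The range of X* = U_S*Y*U_T* is the same, because Y*U_T*U_T = Y*P = Y*.
    have h1 := (hEQY h).conj (by rw [hQd]; exact hUS) hcQ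
    rw [← hVV] at h1
    have h2 := h1.of_range_eq (C := star X) (F := star U_T) (G := U_T) ?_ ?_
    · exact ⟨h2.1, hXiff.mpr (hpos' h), h2⟩
    · rw [hXY]; simp only [star_mul, mul_assoc]
    · have hYP : star Y * P = star Y := by
        have := congrArg star hPY
        rwa [star_mul, hP.1.isSelfAdjoint.star_eq] at this
      rw [hXY, ← hYP, ← hPd]; simp only [star_mul, mul_assoc]
  tfae_finish
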